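/- Let $d$ be a Dyck path of length $n$, i.e. a lattice path from $(0,0)$ to $(n,n)$ with north steps $(0,1)$ and east steps $(1,0)$ that stays weakly above the diagonal $y=x$. Let $G(d)$ be its indifference graph: the graph on $\{1,\dots,n\}$ in which $i<j$ are adjacent if and only if the unit square $[i-1,i]\times[j-1,j]$ lies below $d$. Let $$X_{G(d)}=\sum_{f}\ \prod_{v=1}^n x_{f(v)},$$ the sum over all proper colorings $f\colon\{1,\dots,n\}\to\mathbb{N}$ of $G(d)$, be its chromatic symmetric function, in infinitely many variables indexed by $\mathbb{N}$. Write $$X_{G(d)}=\sum_{\lambda\vdash n} c^d_\lambda\, m_\lambda$$ for its (unique) expansion in the monomial symmetric functions $m_\lambda$, with integer coefficients. If $\mu,\nu$ are partitions of $n$ such that $\mu\succeq\nu$ in dominance order, i.e. $\mu_1+\dots+\mu_k\ge\nu_1+\dots+\nu_k$ for all $k\ge 1$, then $c^d_\mu\le c^d_\nu$. -/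

import Mathlib

/-- The unit cell in column `i` and row `j` (both counted from `0`, columns from the left and rows
from the bottom, so that the cell is the square `[i, i+1] × [j, j+1]`) lies below the path `d`, where
`U` is the north step `(0, 1)` and `D` is the east step `(1, 0)`: on the vertical line `x = i`, the
path passes through some lattice point of height at least `j + 1`. -/
def DyckWord.CellBelow (d : DyckWord) (i j : ℕ) : Prop :=
  ∃ k : ℕ, (d.toList.take k).count DyckStep.D = i ∧ j + 1 ≤ (d.toList.take k).count DyckStep.U

/-- The indifference graph of a Dyck path of length `n` (`n` north and `n` east steps): the vertices
are `0, …, n - 1`, and `i < j` are adjacent iff the cell in column `i` and row `j` is below the path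
(it is above the diagonal because `i < j`). -/
def DyckWord.indifferenceGraph (d : DyckWord) : SimpleGraph (Fin d.semilength) where
  Adj i j := (i < j ∧ d.CellBelow i j) ∨ (j < i ∧ d.CellBelow j i)
  symm := ⟨fun _ _ h => h.symm⟩
  loopless := ⟨fun i h => by
    rcases h with h | h <;> exact lt_irrefl i h.1⟩

/-- The weight of a proper colouring `f`: the exponent vector of `∏ v, x_{f v}`, whose `i`-th entry
is the number of vertices of colour `i`. -/
noncomputable def SimpleGraph.Coloring.weight {V : Type*} [Fintype V] {G : SimpleGraph V}
    (f : G.Coloring ℕ) : ℕ →₀ ℕ :=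
  ∑ v, Finsupp.single (f v) 1

/-- Only finitely many proper colourings have a given weight. -/
theorem SimpleGraph.Coloring.finite_weight_eq {V : Type*} [Fintype V] (G : SimpleGraph V)
    (α : ℕ →₀ ℕ) : Finite {f : G.Coloring ℕ // f.weight = α} := by
  refine Finite.of_injective
    (β := V → α.support) (fun f v => ⟨f.1 v, ?_⟩) ?_
  · have h := DFunLike.congr_fun f.2 (f.1 v)
    rw [SimpleGraph.Coloring.weight, Finsupp.finsetSum_apply] at h
    rw [Finsupp.mem_support_iff, ← h]
    exact (Finset.sum_pos' (fun _ _ => Nat.zero_le _) ⟨v, Finset.mem_univ v, by simp⟩).ne'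
  · intro f g h
    apply Subtype.ext
    apply RelHom.ext
    intro v
    exact congrArg Subtype.val (congrFun h v)

/-- The chromatic symmetric function `X_G = ∑_f ∏_v x_{f v}`, the sum over all proper colourings
`f : V → ℕ`, as a formal power series in the variables `x_0, x_1, x_2, …`: the coefficient of a
monomial `x ^ α` is the (finite) number of proper colourings of weight `α`. -/
noncomputable def SimpleGraph.chromaticSymmetricFunction {V : Type*} [Fintype V]
    (G : SimpleGraph V) : MvPowerSeries ℕ ℤ :=
  fun α => (Nat.card {f : G.Coloring ℕ // f.weight = α} : ℤ)

/-- The monomial symmetric function `m_λ` in the variables `x_0, x_1, x_2, …`: the sum of all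
distinct monomials `x ^ α` whose multiset of nonzero exponents is the multiset of parts of `λ`. -/
noncomputable def Nat.Partition.monomialSymmetricFunction {n : ℕ} (lam : n.Partition) :
    MvPowerSeries ℕ ℤ :=
  fun α => if α.support.val.map α = lam.parts then 1 else 0

/-- `μ.Dominates ν` is `ν ⪯ μ` in dominance order: for every `k`, the sum of the `k` largest parts
of `ν` is at most the sum of the `k` largest parts of `μ`. -/
def Nat.Partition.Dominates {n : ℕ} (μ ν : n.Partition) : Prop :=
  ∀ k : ℕ, ((ν.parts.sort (· ≥ ·)).take k).sum ≤ ((μ.parts.sort (· ≥ ·)).take k).sum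

/-! The coefficient of `m_λ` counts the proper colourings of weight `λ`. Dominance is generated by
moving one unit from an entry to one smaller by at least two (`Finsupp.le_of_dominates`), so it
suffices to inject colourings of weight `α` into those of weight `β` when `β` moves a unit from `i`
to `j` and `α i ≥ α j + 2` (`card_weight_le`). Scan the vertices in order, recording the excess of
`i` over `j`. Since an edge of `G(d)` forces all edges between the vertices it spans, some position
with excess `1` is crossed by no edge between vertices of these colours (`exists_isCut`). Exchanging
`i` and `j` before the first such cut keeps the colouring proper and moves one unit. Cuts survive
and earlier excesses change sign, so the cut can be recovered and the exchange undone. -/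

/-! ### Dyck paths and the interval property of their graphs -/

/-- The number of east steps in a prefix grows by at most one, so every value is attained. -/
theorem DyckWord.exists_count_D_take_eq (d : DyckWord) {k u : ℕ}
    (hk : (d.toList.take k).count DyckStep.D ≤ u) (hu : u ≤ d.semilength) :
    ∃ k', k ≤ k' ∧ (d.toList.take k').count DyckStep.D = u := by
  induction u, hk using Nat.le_induction with
  | base => exact ⟨k, le_rfl, rfl⟩
  | succ u hu' ih =>
    obtain ⟨k₁, hk₁, e₁⟩ := ih (by omega)
    have hex : ∃ m, u + 1 ≤ (d.toList.take (k₁ + m)).count DyckStep.D := by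
      refine ⟨d.toList.length, ?_⟩
      rw [List.take_of_length_le (by omega), ← d.semilength_eq_count_D]
      exact hu
    obtain ⟨m, hm, hmin⟩ : ∃ m, u + 1 ≤ (d.toList.take (k₁ + m)).count DyckStep.D ∧
        ∀ l < m, (d.toList.take (k₁ + l)).count DyckStep.D < u + 1 := by
      classical
      exact ⟨Nat.find hex, Nat.find_spec hex, fun l hl => not_le.1 (Nat.find_min hex hl)⟩
    rcases m with _ | m
    · simp only [add_zero] at hm
      omega
    · refine ⟨k₁ + (m + 1), by omega, le_antisymm ?_ hm⟩
      have h := hmin m (Nat.lt_succ_self m)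
      rw [← add_assoc, List.take_add_one, List.count_append]
      have : (d.toList[k₁ + m]?.toList).count DyckStep.D ≤ 1 :=
        List.count_le_length.trans (by cases d.toList[k₁ + m]? <;> simp)
      omega

/-- A prefix ending on the line `x` extends to one ending on the line `u`, and extending never loses
north steps. -/
theorem DyckWord.CellBelow.mono {d : DyckWord} {x u v w : ℕ} (h : d.CellBelow x w)
    (hxu : x ≤ u) (hvw : v ≤ w) (hu : u ≤ d.semilength) : d.CellBelow u v := by
  obtain ⟨k, hk, hw⟩ := h
  obtain ⟨k', hkk', e⟩ := d.exists_count_D_take_eq (hk.trans_le hxu) hu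
  refine ⟨k', e, ?_⟩
  have := ((List.take_prefix_take_left (l := d.toList) hkk').sublist).count_le DyckStep.U
  omega

/-- A graph on `Fin n` in which an edge forces all edges between vertices it spans. -/
def SimpleGraph.IsIndifference {n : ℕ} (G : SimpleGraph (Fin n)) : Prop :=
  ∀ ⦃x u v w : Fin n⦄, x ≤ u → u < v → v ≤ w → G.Adj x w → G.Adj u v

theorem DyckWord.isIndifference_indifferenceGraph (d : DyckWord) :
    d.indifferenceGraph.IsIndifference := by
  intro x u v w hxu huv hvw h
  rcases h with h | h
  · exact Or.inl ⟨huv, h.2.mono hxu hvw u.2.le⟩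
  · exact absurd h.1 (not_lt.2 (hxu.trans (huv.le.trans hvw)))

/-! ### The colour exchange -/

namespace SimpleGraph.Coloring

theorem weight_apply {V : Type*} [Fintype V] {G : SimpleGraph V} (f : G.Coloring ℕ) (c : ℕ) :
    f.weight c = ∑ v, if f v = c then 1 else 0 := by
  simp [weight, Finsupp.finsetSum_apply, Finsupp.single_apply]

variable {n : ℕ} {G : SimpleGraph (Fin n)} {i j : ℕ}

/-- The colour `i` counts `1`, the colour `j` counts `-1`, the others do not count. -/
def colorSign (i j c : ℕ) : ℤ := (if c = i then 1 else 0) - (if c = j then 1 else 0)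

theorem colorSign_swap (i j c : ℕ) : colorSign i j (Equiv.swap i j c) = -colorSign i j c := by
  unfold colorSign
  rw [Equiv.swap_apply_def]
  split_ifs <;> simp_all

/-- The number of vertices of colour `i` minus the number of vertices of colour `j`, among the
vertices before `t`. -/
def prefixExcess (i j : ℕ) (f : G.Coloring ℕ) (t : ℕ) : ℤ :=
  ∑ v : Fin n, if v.val < t then colorSign i j (f v) else 0

/-- No edge between vertices with colours `i` and `j` crosses the position `t`. -/
def IsCut (i j : ℕ) (f : G.Coloring ℕ) (t : ℕ) : Prop :=
  ∀ v w : Fin n, v.val < t → t ≤ w.val → (f v = i ∨ f v = j) → (f w = i ∨ f w = j) → ¬ G.Adj v w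

theorem prefixExcess_zero (f : G.Coloring ℕ) : f.prefixExcess i j 0 = 0 := by
  simp [prefixExcess]

theorem prefixExcess_succ (f : G.Coloring ℕ) {t : ℕ} (ht : t < n) :
    f.prefixExcess i j (t + 1) = f.prefixExcess i j t + colorSign i j (f ⟨t, ht⟩) := by
  have : colorSign i j (f ⟨t, ht⟩) =
      ∑ v : Fin n, if v = ⟨t, ht⟩ then colorSign i j (f v) else 0 := by simp
  rw [this, prefixExcess, prefixExcess, ← Finset.sum_add_distrib]
  refine Finset.sum_congr rfl fun v _ => ?_
  simp only [Fin.ext_iff]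
  split_ifs <;> omega

theorem prefixExcess_card (f : G.Coloring ℕ) :
    f.prefixExcess i j n = (f.weight i : ℤ) - f.weight j := by
  simp only [prefixExcess, weight_apply, colorSign, Fin.is_lt, if_true, Finset.sum_sub_distrib]
  push_cast
  rfl

/-- The excess cannot pass from `1` to `2` between two cuts. -/
theorem exists_isCut (hG : G.IsIndifference) (hij : i ≠ j) (f : G.Coloring ℕ)
    (h : f.weight j + 2 ≤ f.weight i) : ∃ t, f.IsCut i j t ∧ f.prefixExcess i j t = 1 := by
  by_contra hno
  push Not at hno
  -- Invariant if no cut has excess `1`: the excess stays at most `1`, and when it equals `1` the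
  -- last vertex coloured `i` or `j` has colour `i`.
  have key : ∀ t ≤ n, f.prefixExcess i j t ≤ 1 ∧ (f.prefixExcess i j t = 1 →
      ∃ u : Fin n, u.val < t ∧ f u = i ∧
        ∀ x : Fin n, x.val < t → (f x = i ∨ f x = j) → x ≤ u) := by
    intro t
    induction t with
    | zero => simp [prefixExcess_zero]
    | succ t ih =>
      intro ht
      obtain ⟨h1, h2⟩ := ih (by omega)
      rw [prefixExcess_succ f (by omega)]
      have ht' : t < n := by omega
      by_cases hi : f ⟨t, ht'⟩ = i
      · have hs : colorSign i j (f ⟨t, ht'⟩) = 1 := by simp [colorSign, hi, hij]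
        rw [hs]
        -- Otherwise an edge crosses `t`; it spans both `u` and `t`, which are then adjacent
        -- although both have colour `i`.
        have h0 : f.prefixExcess i j t ≠ 1 := by
          intro h0
          obtain ⟨u, hut, hu, hmax⟩ := h2 h0
          have hc : ¬ f.IsCut i j t := fun hc => hno t hc h0
          unfold IsCut at hc
          push Not at hc
          obtain ⟨x, w, hx, hw, hfx, -, hadj⟩ := hc
          exact f.valid (hG (v := ⟨t, ht'⟩) (hmax x hx hfx) hut hw hadj) (hu.trans hi.symm)
        refine ⟨by omega, fun _ => ⟨⟨t, ht'⟩, Nat.lt_succ_self t, hi, fun x hx _ => ?_⟩⟩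
        exact Nat.lt_succ_iff.1 hx
      · by_cases hj : f ⟨t, ht'⟩ = j
        · have hs : colorSign i j (f ⟨t, ht'⟩) = -1 := by simp [colorSign, hj, hij.symm]
          rw [hs]
          exact ⟨by omega, fun _ => by omega⟩
        · have hs : colorSign i j (f ⟨t, ht'⟩) = 0 := by simp [colorSign, hi, hj]
          rw [hs, add_zero]
          refine ⟨h1, fun h0 => ?_⟩
          obtain ⟨u, hut, hu, hmax⟩ := h2 h0
          refine ⟨u, by omega, hu, fun x hx hfx => ?_⟩
          rcases Nat.lt_succ_iff_lt_or_eq.1 hx with hx | hx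
          · exact hmax x hx hfx
          · have : x = ⟨t, ht'⟩ := Fin.ext hx
            subst this
            exact absurd hfx (by tauto)
  have := (key n le_rfl).1
  rw [prefixExcess_card] at this
  omega

/-- Exchange the colours `i` and `j` before the cut `t`. -/
def swapPrefix (f : G.Coloring ℕ) {t : ℕ} (h : f.IsCut i j t) : G.Coloring ℕ :=
  Coloring.mk (fun v => if v.val < t then Equiv.swap i j (f v) else f v) <| by
    -- Only edges crossing `t` matter. One end has a colour outside `{i, j}`, and the swap preserves
    -- this set and fixes all other colours.
    have key : ∀ v w : Fin n, v.val < t → t ≤ w.val → G.Adj v w →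
        Equiv.swap i j (f v) ≠ f w := by
      intro v w hv hw hadj heq
      have h1 := h v w hv hw
      have h2 := f.valid hadj
      rw [Equiv.swap_apply_def] at heq
      split_ifs at heq <;> simp_all
    intro v w hadj
    by_cases hv : v.val < t <;> by_cases hw : w.val < t
    · simpa [hv, hw] using f.valid hadj
    · simpa [hv, hw] using key v w hv (not_lt.1 hw) hadj
    · simpa [hv, hw] using (key w v hw (not_lt.1 hv) hadj.symm).symm
    · simpa [hv, hw] using f.valid hadj

theorem swapPrefix_apply (f : G.Coloring ℕ) {t : ℕ} (h : f.IsCut i j t) (v : Fin n) :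
    f.swapPrefix h v = if v.val < t then Equiv.swap i j (f v) else f v := rfl

theorem swapPrefix_mem_iff (f : G.Coloring ℕ) {t : ℕ} (h : f.IsCut i j t) (v : Fin n) :
    (f.swapPrefix h v = i ∨ f.swapPrefix h v = j) ↔ (f v = i ∨ f v = j) := by
  rw [swapPrefix_apply]
  split_ifs
  · rw [Equiv.swap_apply_def]
    split_ifs <;> simp_all
  · rfl

theorem isCut_swapPrefix_iff (f : G.Coloring ℕ) {t : ℕ} (h : f.IsCut i j t) (s : ℕ) :
    (f.swapPrefix h).IsCut i j s ↔ f.IsCut i j s := by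
  simp only [IsCut, swapPrefix_mem_iff]

theorem prefixExcess_swapPrefix (f : G.Coloring ℕ) {t : ℕ} (h : f.IsCut i j t) {s : ℕ}
    (hs : s ≤ t) : (f.swapPrefix h).prefixExcess i j s = -f.prefixExcess i j s := by
  rw [prefixExcess, prefixExcess, ← Finset.sum_neg_distrib]
  refine Finset.sum_congr rfl fun v _ => ?_
  split_ifs with hv
  · rw [swapPrefix_apply, if_pos (by omega), colorSign_swap]
  · simp

/-- The exchange transfers the excess before `t`, here one unit, from `i` to `j`. -/
theorem weight_swapPrefix (f : G.Coloring ℕ) {t : ℕ} (h : f.IsCut i j t)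
    (ht : f.prefixExcess i j t = 1) :
    (f.swapPrefix h).weight + Finsupp.single i 1 = f.weight + Finsupp.single j 1 := by
  ext c
  have key : ((f.swapPrefix h).weight c : ℤ) =
      f.weight c + f.prefixExcess i j t * ((if c = j then 1 else 0) - (if c = i then 1 else 0)) := by
    rw [weight_apply, weight_apply, prefixExcess, Finset.sum_mul]
    push_cast
    rw [← Finset.sum_add_distrib]
    refine Finset.sum_congr rfl fun v _ => ?_
    rw [swapPrefix_apply]
    unfold colorSign
    by_cases hv : v.val < t
    · simp only [hv, if_true]
      rw [Equiv.swap_apply_def]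
      split_ifs <;> omega
    · simp [hv]
  rw [ht, one_mul] at key
  simp only [Finsupp.add_apply, Finsupp.single_apply]
  split_ifs at key ⊢ <;> omega

/-- Moving a vertex from a colour class to one that is smaller by at least two does not decrease
the number of proper colourings. -/
theorem card_weight_le (hG : G.IsIndifference) (hij : i ≠ j) {α β : ℕ →₀ ℕ}
    (hα : α j + 2 ≤ α i) (hβ : β + Finsupp.single i 1 = α + Finsupp.single j 1) :
    Nat.card {f : G.Coloring ℕ // f.weight = α} ≤ Nat.card {f : G.Coloring ℕ // f.weight = β} := by
  classical
  have hex : ∀ f : {f : G.Coloring ℕ // f.weight = α},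
      ∃ t, f.1.IsCut i j t ∧ f.1.prefixExcess i j t = 1 :=
    fun f => exists_isCut hG hij f.1 (by rw [f.2]; exact hα)
  have := finite_weight_eq G β
  refine Nat.card_le_card_of_injective
    (fun f => ⟨f.1.swapPrefix (Nat.find_spec (hex f)).1, ?_⟩) ?_
  · have h := weight_swapPrefix f.1 (Nat.find_spec (hex f)).1 (Nat.find_spec (hex f)).2
    rw [f.2, ← hβ] at h
    exact add_right_cancel h
  · intro f g hfg
    replace hfg : f.1.swapPrefix (Nat.find_spec (hex f)).1 =
      g.1.swapPrefix (Nat.find_spec (hex g)).1 := congrArg Subtype.val hfg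
    have hle : ∀ (f g : {f : G.Coloring ℕ // f.weight = α}),
        f.1.swapPrefix (Nat.find_spec (hex f)).1 = g.1.swapPrefix (Nat.find_spec (hex g)).1 →
        Nat.find (hex f) ≤ Nat.find (hex g) := by
      intro f g hfg
      by_contra hlt
      push Not at hlt
      -- An earlier cut of `g` would be a cut of `f` with excess `1`: both are read off from the
      -- common image, where the excess is `-1`.
      refine Nat.find_min (hex f) hlt ⟨?_, ?_⟩
      · rw [← isCut_swapPrefix_iff f.1 (Nat.find_spec (hex f)).1, hfg, isCut_swapPrefix_iff]
        exact (Nat.find_spec (hex g)).1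
      · rw [← neg_inj, ← prefixExcess_swapPrefix f.1 (Nat.find_spec (hex f)).1 hlt.le, hfg,
          prefixExcess_swapPrefix _ _ le_rfl, (Nat.find_spec (hex g)).2]
    have ht : Nat.find (hex f) = Nat.find (hex g) := (hle f g hfg).antisymm (hle g f hfg.symm)
    apply Subtype.ext
    apply RelHom.ext
    intro v
    have hv := DFunLike.congr_fun hfg v
    rw [swapPrefix_apply, swapPrefix_apply, ht] at hv
    split_ifs at hv
    · exact (Equiv.swap i j).injective hv
    · exact hv

/-- The number of proper colourings of given weight does not depend on the names of the colours. -/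
theorem card_weight_mapDomain {V : Type*} [Fintype V] (G : SimpleGraph V) (σ : Equiv.Perm ℕ)
    (α : ℕ →₀ ℕ) :
    Nat.card {f : G.Coloring ℕ // f.weight = α.mapDomain σ} =
      Nat.card {f : G.Coloring ℕ // f.weight = α} := by
  have hle : ∀ (σ : Equiv.Perm ℕ) (α : ℕ →₀ ℕ), Nat.card {f : G.Coloring ℕ // f.weight = α} ≤
      Nat.card {f : G.Coloring ℕ // f.weight = α.mapDomain σ} := by
    intro σ α
    have := finite_weight_eq G (α.mapDomain σ)
    refine Nat.card_le_card_of_injective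
      (fun f => ⟨Coloring.mk (fun v => σ (f.1 v)) fun h => σ.injective.ne (f.1.valid h), ?_⟩) ?_
    · conv_rhs => rw [← f.2]
      simp [weight, Finsupp.mapDomain_finsetSum, Finsupp.mapDomain_single]
      rfl
    · intro f g hfg
      apply Subtype.ext
      apply RelHom.ext
      intro v
      exact σ.injective (DFunLike.congr_fun (congrArg Subtype.val hfg) v)
  refine le_antisymm ?_ (hle σ α)
  have h := hle σ.symm (α.mapDomain σ)
  rwa [← Finsupp.mapDomain_comp, Equiv.symm_comp_self, Finsupp.mapDomain_id] at h

theorem degree_weight {V : Type*} [Fintype V] {G : SimpleGraph V} (f : G.Coloring ℕ) :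
    f.weight.degree = Fintype.card V := by
  simp [weight]

end SimpleGraph.Coloring

/-! ### Dominance order and unit transfers -/

/-- A function of finitely supported sequences which does not decrease when a unit is moved from
one entry to an entry smaller by at least two is antitone for the dominance order. -/
theorem Finsupp.le_of_dominates {N : (ℕ →₀ ℕ) → ℕ}
    (hN : ∀ (α β : ℕ →₀ ℕ) (i j : ℕ), i ≠ j → α j + 2 ≤ α i → β + single i 1 = α + single j 1 →
      N α ≤ N β) {ν : ℕ →₀ ℕ} (hν : Antitone ν) (μ : ℕ →₀ ℕ) (hdeg : μ.degree = ν.degree)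
    (hdom : ∀ k, ∑ l ∈ Finset.range k, ν l ≤ ∑ l ∈ Finset.range k, μ l) : N μ ≤ N ν := by
  classical
  induction hm : (μ - ν).degree generalizing μ with
  | zero =>
    have h0 : μ ≤ ν := tsub_eq_zero_iff_le.1 ((Finsupp.degree_eq_zero_iff _).1 hm)
    obtain ⟨ρ, rfl⟩ := exists_add_of_le h0
    have : ρ = 0 := by
      rw [← Finsupp.degree_eq_zero_iff]
      rw [map_add] at hdeg
      omega
    simp [this]
  | succ m ih =>
    have hlt : ∃ j, μ j < ν j := by
      by_contra! hle
      obtain ⟨ρ, rfl⟩ := exists_add_of_le (show ν ≤ μ from hle)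
      rw [add_tsub_cancel_left] at hm
      rw [map_add] at hdeg
      omega
    obtain ⟨j, hj, hmin⟩ : ∃ j, μ j < ν j ∧ ∀ l < j, ν l ≤ μ l :=
      ⟨Nat.find hlt, Nat.find_spec hlt, fun l hl => not_lt.1 (Nat.find_min hlt hl)⟩
    -- Dominance at `j + 1` needs an earlier surplus to offset the deficit at `j`. As `ν` decreases,
    -- `μ i > ν i ≥ ν j > μ j`, hence the gap of two. The new sequence need not be sorted.
    obtain ⟨i, hij, hi⟩ : ∃ i < j, ν i < μ i := by
      by_contra! hle
      have h1 := hdom (j + 1)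
      rw [Finset.sum_range_succ, Finset.sum_range_succ] at h1
      have h2 : ∑ l ∈ Finset.range j, μ l ≤ ∑ l ∈ Finset.range j, ν l :=
        Finset.sum_le_sum fun l hl => hle l (Finset.mem_range.1 hl)
      omega
    have hνij := hν hij.le
    obtain ⟨ρ, rfl⟩ : ∃ ρ, μ = ρ + single i 1 := by
      obtain ⟨ρ, hρ⟩ := exists_add_of_le (show single i 1 ≤ μ by
        rw [Finsupp.single_le_iff]; omega)
      exact ⟨ρ, by rw [hρ, add_comm]⟩
    simp only [Finsupp.add_apply, Finsupp.single_eq_same, Finsupp.single_apply] at hi hj hmin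
    rw [if_neg hij.ne] at hj
    refine (hN _ (ρ + single j 1) i j hij.ne ?_ (by abel)).trans (ih _ ?_ ?_ ?_)
    · simp only [Finsupp.add_apply, Finsupp.single_eq_same, Finsupp.single_apply, if_neg hij.ne]
      omega
    · simpa using hdeg
    · intro k
      have hk := hdom k
      simp only [Finsupp.add_apply, Finset.sum_add_distrib, Finsupp.single_apply,
        Finset.sum_ite_eq, Finset.mem_range] at hk ⊢
      -- Beyond `j` the partial sums are unchanged; up to `j` dominance holds entry by entry.
      by_cases hjk : j < k
      · rw [if_pos hjk]
        rw [if_pos (hij.trans hjk)] at hk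
        exact hk
      · rw [if_neg hjk, add_zero]
        refine Finset.sum_le_sum fun l hl => ?_
        have hl' := hmin l ((Finset.mem_range.1 hl).trans_le (not_lt.1 hjk))
        split_ifs at hl' with h
        · subst h; omega
        · exact hl'
    · have e : (ρ + single i 1 - ν) = (ρ + single j 1 - ν) + single i 1 := by
        ext l
        simp only [Finsupp.tsub_apply, Finsupp.add_apply, Finsupp.single_apply]
        by_cases h1 : i = l <;> by_cases h2 : j = l
        · omega
        · subst h1; simp [h2]; omega
        · subst h2; simp [h1]; omega
        · simp [h1, h2]
      rw [e, map_add, Finsupp.degree_single] at hm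
      omega

/-! ### Expansion in monomial symmetric functions -/

/-- Two finitely supported functions with the same multiset of nonzero values differ by a
permutation. -/
theorem Finsupp.exists_mapDomain_eq {α β : ℕ →₀ ℕ}
    (h : α.support.val.map α = β.support.val.map β) :
    ∃ σ : Equiv.Perm ℕ, β.mapDomain σ = α := by
  -- Fibres over nonzero values are finite of equal size; both fibres over `0` are countably
  -- infinite.
  have hfib : ∀ c, Nonempty ({a // α a = c} ≃ {a // β a = c}) := by
    intro c
    rcases eq_or_ne c 0 with rfl | hc
    · have hinf : ∀ γ : ℕ →₀ ℕ, Infinite {a // γ a = 0} := by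
        intro γ
        refine Set.infinite_coe_iff.2 ((γ.support.finite_toSet.infinite_compl).mono ?_)
        intro a ha
        exact Finsupp.notMem_support_iff.1 ha
      have := hinf α
      have := hinf β
      exact nonempty_equiv_of_countable
    · have hfin : ∀ γ : ℕ →₀ ℕ, Finite {a // γ a = c} ∧
          Nat.card {a // γ a = c} = (γ.support.val.map γ).count c := by
        intro γ
        have hmem : ∀ a, a ∈ γ.support.filter (c = γ ·) ↔ γ a = c := by
          intro a
          simp only [Finset.mem_filter, Finsupp.mem_support_iff]
          exact ⟨fun h => h.2.symm, fun h => ⟨h ▸ hc, h.symm⟩⟩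
        refine ⟨((γ.support.filter (c = γ ·)).finite_toSet.subset fun a ha => (hmem a).2 ha), ?_⟩
        rw [Nat.subtype_card _ hmem, Multiset.count_map]
        rfl
      have := (hfin α).1
      have := (hfin β).1
      exact Finite.card_eq.1 (by rw [(hfin α).2, (hfin β).2, h])
  refine ⟨(Equiv.ofFiberEquiv fun c => (hfib c).some).symm, ?_⟩
  ext a
  rw [Finsupp.mapDomain_equiv_apply, Equiv.symm_symm]
  exact Equiv.ofFiberEquiv_map _ a

theorem List.sum_range_getD (l : List ℕ) (k : ℕ) :
    ∑ i ∈ Finset.range k, l.getD i 0 = (l.take k).sum := by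
  induction k with
  | zero => simp
  | succ k ih =>
    rw [Finset.sum_range_succ, ih, List.take_add_one, List.sum_append, List.getD_eq_getElem?_getD]
    cases l[k]? <;> simp

namespace Nat.Partition

variable {n : ℕ}

/-- The weakly decreasing sequence of the parts of a partition, continued by zeros. -/
noncomputable def toFinsupp (lam : n.Partition) : ℕ →₀ ℕ :=
  (lam.parts.sort (· ≥ ·)).toFinsupp

theorem toFinsupp_apply (lam : n.Partition) (k : ℕ) :
    lam.toFinsupp k = (lam.parts.sort (· ≥ ·)).getD k 0 := rfl

theorem antitone_toFinsupp (lam : n.Partition) : Antitone lam.toFinsupp := by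
  intro a b hab
  rw [toFinsupp_apply, toFinsupp_apply]
  rcases lt_or_ge b (lam.parts.sort (· ≥ ·)).length with hb | hb
  · rw [List.getD_eq_getElem _ _ hb, List.getD_eq_getElem _ _ (hab.trans_lt hb)]
    rcases hab.eq_or_lt with rfl | hab
    · exact le_rfl
    · exact List.pairwise_iff_getElem.1 (Multiset.pairwise_sort lam.parts (· ≥ ·)) a b _ hb hab
  · rw [List.getD_eq_default _ _ hb]
    exact Nat.zero_le _

theorem map_support_toFinsupp (lam : n.Partition) :
    lam.toFinsupp.support.val.map lam.toFinsupp = lam.parts := by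
  have hsupp : lam.toFinsupp.support = Finset.range (lam.parts.sort (· ≥ ·)).length := by
    ext k
    rw [Finsupp.mem_support_iff, toFinsupp_apply, Finset.mem_range]
    refine ⟨fun h => not_le.1 fun hk => h (List.getD_eq_default _ _ hk), fun hk => ?_⟩
    rw [List.getD_eq_getElem _ _ hk]
    exact (lam.parts_pos ((Multiset.mem_sort (· ≥ ·)).1 (List.getElem_mem hk))).ne'
  conv_rhs => rw [← Multiset.sort_eq lam.parts (· ≥ ·)]
  rw [hsupp, Finset.range_val, Multiset.range, Multiset.map_coe]
  congr 1
  refine List.ext_getElem (by simp) fun k h1 h2 => ?_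
  rw [List.getElem_map, List.getElem_range, toFinsupp_apply, List.getD_eq_getElem _ _ h2]

theorem degree_toFinsupp (lam : n.Partition) : lam.toFinsupp.degree = n := by
  exact (congrArg Multiset.sum lam.map_support_toFinsupp).trans lam.parts_sum

/-- The partition formed by the nonzero values of a finitely supported function. -/
def ofDegree (α : ℕ →₀ ℕ) (h : α.degree = n) : n.Partition where
  parts := α.support.val.map α
  parts_pos := by
    intro a ha
    obtain ⟨b, hb, rfl⟩ := Multiset.mem_map.1 ha
    exact Nat.pos_of_ne_zero (Finsupp.mem_support_iff.1 hb)
  parts_sum := h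

theorem sum_smul_monomialSymmetricFunction_apply (c : n.Partition → ℤ) (lam : n.Partition)
    (α : ℕ →₀ ℕ) (h : α.support.val.map α = lam.parts) :
    (∑ l, c l • l.monomialSymmetricFunction) α = c lam := by
  have : (∑ l, c l • l.monomialSymmetricFunction) α =
      ∑ l, c l * l.monomialSymmetricFunction α := Finset.sum_apply α Finset.univ _
  rw [this, Finset.sum_eq_single lam]
  · simp [monomialSymmetricFunction, h]
  · intro l _ hl
    rw [monomialSymmetricFunction, if_neg, mul_zero]
    intro h'
    exact hl (Nat.Partition.ext (h'.symm.trans h))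
  · simp

theorem sum_smul_monomialSymmetricFunction_apply_eq_zero (c : n.Partition → ℤ)
    (α : ℕ →₀ ℕ) (h : α.degree ≠ n) : (∑ l, c l • l.monomialSymmetricFunction) α = 0 := by
  have : (∑ l, c l • l.monomialSymmetricFunction) α =
      ∑ l, c l * l.monomialSymmetricFunction α := Finset.sum_apply α Finset.univ _
  rw [this]
  refine Finset.sum_eq_zero fun l _ => ?_
  rw [monomialSymmetricFunction, if_neg, mul_zero]
  intro h'
  exact h ((congrArg Multiset.sum h').trans l.parts_sum)

end Nat.Partition

namespace SimpleGraph

theorem chromaticSymmetricFunction_apply_congr {V : Type*} [Fintype V] (G : SimpleGraph V)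
    {α β : ℕ →₀ ℕ} (h : α.support.val.map α = β.support.val.map β) :
    G.chromaticSymmetricFunction α = G.chromaticSymmetricFunction β := by
  obtain ⟨σ, rfl⟩ := Finsupp.exists_mapDomain_eq h
  exact congrArg Nat.cast (Coloring.card_weight_mapDomain G σ β)

/-- By symmetry in the colours, the coefficient at an exponent of degree `n` equals the one at its
sorted rearrangement. In other degrees both sides vanish, since a colouring has total weight `n`. -/
theorem chromaticSymmetricFunction_eq_sum {n : ℕ} (G : SimpleGraph (Fin n)) :
    G.chromaticSymmetricFunction = ∑ lam : n.Partition,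
      G.chromaticSymmetricFunction lam.toFinsupp • lam.monomialSymmetricFunction := by
  funext α
  by_cases h : α.degree = n
  · rw [Nat.Partition.sum_smul_monomialSymmetricFunction_apply _ (.ofDegree α h) α rfl]
    refine chromaticSymmetricFunction_apply_congr G ?_
    rw [Nat.Partition.map_support_toFinsupp]
    rfl
  · rw [Nat.Partition.sum_smul_monomialSymmetricFunction_apply_eq_zero _ α h]
    have : IsEmpty {f : G.Coloring ℕ // f.weight = α} :=
      ⟨fun f => h (by rw [← f.2, Coloring.degree_weight, Fintype.card_fin])⟩
    rw [chromaticSymmetricFunction, Nat.card_of_isEmpty, Nat.cast_zero]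

/-- Among the `m_l`, only `m_lam` contains the monomial with exponent `lam.toFinsupp`; this gives
uniqueness. -/
theorem eq_chromaticSymmetricFunction_apply {n : ℕ} {G : SimpleGraph (Fin n)}
    {c : n.Partition → ℤ}
    (h : G.chromaticSymmetricFunction = ∑ lam, c lam • lam.monomialSymmetricFunction)
    (lam : n.Partition) : c lam = G.chromaticSymmetricFunction lam.toFinsupp := by
  rw [h, Nat.Partition.sum_smul_monomialSymmetricFunction_apply c lam _ lam.map_support_toFinsupp]

theorem IsIndifference.chromaticSymmetricFunction_le {n : ℕ} {G : SimpleGraph (Fin n)}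
    (hG : G.IsIndifference) {μ ν : n.Partition} (h : μ.Dominates ν) :
    G.chromaticSymmetricFunction μ.toFinsupp ≤ G.chromaticSymmetricFunction ν.toFinsupp := by
  refine Nat.cast_le.2 (Finsupp.le_of_dominates
    (N := fun α => Nat.card {f : G.Coloring ℕ // f.weight = α})
    (fun α β i j hij hα hβ => Coloring.card_weight_le hG hij hα hβ)
    ν.antitone_toFinsupp μ.toFinsupp (by rw [μ.degree_toFinsupp, ν.degree_toFinsupp]) fun k => ?_)
  simp only [Nat.Partition.toFinsupp_apply, List.sum_range_getD]
  exact h k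

end SimpleGraph

theorem mainTheorem7 (d : DyckWord) :
    (∃! c : d.semilength.Partition → ℤ,
      d.indifferenceGraph.chromaticSymmetricFunction =
        ∑ lam, c lam • lam.monomialSymmetricFunction) ∧
    ∀ c : d.semilength.Partition → ℤ,
      d.indifferenceGraph.chromaticSymmetricFunction =
        ∑ lam, c lam • lam.monomialSymmetricFunction →
      ∀ μ ν : d.semilength.Partition, μ.Dominates ν → c μ ≤ c ν := by
  refine ⟨⟨_, d.indifferenceGraph.chromaticSymmetricFunction_eq_sum, fun c hc => ?_⟩,
    fun c hc μ ν h => ?_⟩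
  · exact funext fun lam => SimpleGraph.eq_chromaticSymmetricFunction_apply hc lam
  · rw [SimpleGraph.eq_chromaticSymmetricFunction_apply hc μ,
      SimpleGraph.eq_chromaticSymmetricFunction_apply hc ν]
    exact d.isIndifference_indifferenceGraph.chromaticSymmetricFunction_le h
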